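/- Let $k$ be an algebraically closed field, let $X$ be an elliptic curve over $k$ (a proper, smooth, geometrically integral $k$-group scheme of dimension one), and let $D = x \in X$ be a closed point, regarded as a reduced effective Cartier divisor. (1) There exist an affine open neighbourhood $U \subset X$ of $D$ and a regular function $u \in \Gamma(U, \mathcal{O}_U)$, not a zero divisor, such that $D$ is the principal effective divisor $(u)$ on $U$ and the induced $k$-morphism $u\colon U \setminus D \to \mathbb{A}^1_k$ is étale. (2) Let $U \subset X$ be any affine open neighbourhood of $D$ (in particular, any $U$ as in (1)). Then there is no pair $(f, D')$ consisting of a finite morphism of $k$-schemes $f\colon U \to \mathbb{A}^1_k$ and an effective Cartier divisor $D' \hookrightarrow \mathbb{A}^1_k$ such that $D = f^*(D')$, i.e. such that the scheme-theoretic inverse image $f^{-1}(D')$ is the reduced closed point $D \subset U$. -/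

import Mathlib

open CategoryTheory Limits AlgebraicGeometry

universe u

namespace Sharpness

/-- An elliptic curve over a field `k`: a one-dimensional abelian variety, that is, a proper,
smooth, geometrically integral `k`-scheme of dimension one that admits the structure of a
group scheme over `k`. -/
structure IsEllipticCurve {k : Type u} [Field k] (X : Over (Spec (CommRingCat.of k))) :
    Prop where
  isProper : IsProper X.hom
  smooth : SmoothOfRelativeDimension 1 X.hom
  geometricallyIntegral : GeometricallyIntegral X.hom
  nonempty_grpObj : Nonempty (GrpObj X)

/-- A closed subscheme (given by its quasi-coherent ideal sheaf) is an effective Cartier divisor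
if its ideal sheaf is, locally on affine opens, generated by one non-zero-divisor. -/
def IsEffectiveCartier {Y : Scheme.{u}} (I : Y.IdealSheafData) : Prop :=
  ∀ y : Y, ∃ W : Y.affineOpens, y ∈ W.1 ∧
    ∃ a ∈ nonZeroDivisors Γ(Y, W.1), I.ideal W = Ideal.span {a}

/-- The ideal sheaf of a closed point, viewed as a reduced closed subscheme. -/
noncomputable def closedPoint {Y : Scheme.{u}} (x : Y) (hx : IsClosed ({x} : Set Y)) :
    Y.IdealSheafData :=
  Scheme.IdealSheafData.vanishingIdeal ⟨{x}, hx⟩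

/-- The ideal sheaf on the open subscheme `U` of the restriction to `U` of a closed point. -/
noncomputable def closedPointOn {Y : Scheme.{u}} (x : Y) (hx : IsClosed ({x} : Set Y))
    (U : Y.Opens) : U.toScheme.IdealSheafData :=
  (closedPoint x hx).comap U.ι

/-- The affine line over `k`. -/
noncomputable abbrev AffineLine (k : Type u) [Field k] : Scheme.{u} :=
  AffineSpace PUnit.{u + 1} (Spec (CommRingCat.of k))

/-- The `k`-morphism from an open subscheme `U` of `X` to the affine line that is defined by a
regular function on `U`. -/
noncomputable def toAffineLine {k : Type u} [Field k] (X : Over (Spec (CommRingCat.of k)))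
    (U : X.left.Opens) (u : Γ(U.toScheme, ⊤)) : U.toScheme ⟶ AffineLine k :=
  AffineSpace.homOfVector (U.ι ≫ X.hom) (fun _ => u)

/-- `U` is an affine open neighbourhood of the closed point `x`, on which `x` is the principal
effective divisor of the regular function `u`, and `u : U ∖ {x} ⟶ 𝔸¹` is étale. -/
structure IsSpecialNeighbourhood {k : Type u} [Field k] (X : Over (Spec (CommRingCat.of k)))
    (x : X.left) (hx : IsClosed ({x} : Set X.left))
    (U : X.left.Opens) (u : Γ(U.toScheme, ⊤)) : Prop where
  isAffine : IsAffineOpen U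
  mem : x ∈ U
  mem_nonZeroDivisors : u ∈ nonZeroDivisors Γ(U.toScheme, ⊤)
  eq_principal : closedPointOn x hx U = Scheme.IdealSheafData.ofIdealTop (Ideal.span {u})
  etale : Etale
    ((U.ι ⁻¹ᵁ (⟨{x}ᶜ, hx.isOpen_compl⟩ : X.left.Opens)).ι ≫ toAffineLine X U u)

end Sharpness

/-! For (1), a smooth curve is étale over the line near `x`. Translate the coordinate so that `x`
lies over the origin. The fibre over the origin is then étale over `k`, hence a finite set of
reduced points, and inverting a function that vanishes on the other points makes the coordinate
generate the ideal of `x` (`exists_mul_mem_span_of_etale`).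

For (2), suppose `D = f^*(D')` with `f` finite, and let `B` be the coordinate ring of `U`. It is
finite and torsion-free over the principal ideal domain `k[X]`, hence free, and its rank can be read
off in the fibre through `x`. Since the ideal of `x` is extended from `k[X]`, that fibre is a single
reduced rational point, so the rank is one and `f` is an isomorphism
(`bijective_algebraMap_of_map_eq_ker`).

Thus `X` would contain the affine line as an open subscheme. Instead of the genus, the contradiction
uses fixed points (`exists_fixed_point`). An automorphism of such a proper curve is a rational
function `g = p / q` on the line. Either `g(c) = c` for some `c` where `g` is defined, or `g` has a
pole at infinity and the limit point of the line at infinity is fixed. But a nontrivial translation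
of a group has no fixed point (`not_isOpenImmersion_of_grpObj`). -/

namespace Sharpness

open Polynomial TensorProduct

/-! ### Commutative algebra over the polynomial ring -/

section Algebra

variable {k : Type u} [Field k]

/-- At a rational point of an étale algebra over `k[X]` lying over the origin, the coordinate `X`
generates the maximal ideal after inverting one function that does not vanish at the point. -/
theorem exists_mul_mem_span_of_etale {A : Type*} [CommRing A] [Algebra k[X] A]
    [Algebra.Etale k[X] A] (e : A →+* k)
    (ht : e (algebraMap k[X] A X) = 0) :
    ∃ s : A, e s ≠ 0 ∧ ∀ a, e a = 0 → s * a ∈ Ideal.span {algebraMap k[X] A X} := by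
  set t := algebraMap k[X] A X
  let : Algebra k A := ((algebraMap k[X] A).comp C).toAlgebra
  have : IsScalarTower k k[X] A := .of_algebraMap_eq fun _ ↦ rfl
  let : Algebra k[X] k := (evalRingHom 0).toAlgebra
  let Q := A ⧸ Ideal.span {t}
  -- Since `t` is zero in `Q`, the structure map from `k[X]` factors through evaluation at the
  -- origin. This turns unramifiedness over `k[X]` into unramifiedness over `k`, so `Q` is finite
  -- and reduced, hence semisimple.
  have : IsScalarTower k[X] k Q := by
    refine .of_algebraMap_eq' (Polynomial.ringHom_ext' ?_ ?_)
    · ext a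
      simp [RingHom.algebraMap_toAlgebra, Q]
      rfl
    · simp [RingHom.algebraMap_toAlgebra, Q]
      exact Ideal.Quotient.eq_zero_iff_mem.mpr (Ideal.mem_span_singleton_self t)
  have : Algebra.FormallyUnramified k[X] Q := inferInstance
  have : Algebra.FormallyUnramified k Q := .of_restrictScalars k[X] k Q
  have : Algebra.FiniteType k[X] A := inferInstance
  have : Algebra.FiniteType k A := .trans (S := k[X]) inferInstance inferInstance
  have : Algebra.FiniteType k Q := .of_surjective (Ideal.Quotient.mkₐ k _)
    Ideal.Quotient.mk_surjective
  have : Module.Finite k Q := Algebra.FormallyUnramified.finite_of_free k Q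
  have : IsReduced Q := Algebra.FormallyUnramified.isReduced_of_field k Q
  have : IsArtinianRing Q := IsArtinianRing.of_finite k Q
  have : IsSemisimpleRing Q := IsArtinianRing.isSemisimpleRing_of_isReduced Q
  let e' : Q →+* k := Ideal.Quotient.lift _ e fun a ha ↦ by
    obtain ⟨b, rfl⟩ := Ideal.mem_span_singleton'.mp ha
    simp [ht]
  -- The `J`-component of `1` is the required function: it takes the value `1` at the point, and its
  -- product with anything vanishing there lies in `ker e' ⊓ J = ⊥`.
  obtain ⟨J, hJ⟩ := exists_isCompl (RingHom.ker e' : Submodule Q Q)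
  have h1 : (1 : Q) ∈ RingHom.ker e' ⊔ J := hJ.sup_eq_top ▸ Submodule.mem_top
  obtain ⟨a, ha, b, hb, hab⟩ := Submodule.mem_sup.mp h1
  obtain ⟨s, rfl⟩ := Ideal.Quotient.mk_surjective b
  have hs : e s = 1 := by
    have := congr(e' $hab)
    rw [map_add, RingHom.mem_ker.mp ha, zero_add, map_one] at this
    exact this
  refine ⟨s, by simp [hs], fun c hc ↦ ?_⟩
  rw [← Ideal.Quotient.eq_zero_iff_mem, ← Submodule.mem_bot Q, ← hJ.inf_eq_bot]
  refine ⟨?_, ?_⟩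
  · rw [SetLike.mem_coe, RingHom.mem_ker]
    change e (s * c) = 0
    simp [hc]
  · rw [map_mul, mul_comm]
    exact J.smul_mem _ hb

/-- A finite algebra over `k[X]`, integral and of positive dimension at a rational point `e`, is
`k[X]` itself as soon as the ideal of the point is extended from `k[X]`. -/
theorem bijective_algebraMap_of_map_eq_ker {B : Type*} [CommRing B] [IsDomain B] [Algebra k[X] B]
    [Module.Finite k[X] B] (e : B →+* k)
    (he : (e.comp (algebraMap k[X] B)).comp C = RingHom.id k) (hne : RingHom.ker e ≠ ⊥)
    (J : Ideal k[X]) (hJ : J.map (algebraMap k[X] B) = RingHom.ker e) :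
    Function.Bijective (algebraMap k[X] B) := by
  have he' (a : k) : e (algebraMap k[X] B (C a)) = a := congr($he a)
  -- A nonzero polynomial in the kernel would make the image of `X` algebraic over `k`. Then `B` is
  -- a domain integral over `k`, hence a field, and `e` is injective, against `hne`.
  have hinj : Function.Injective (algebraMap k[X] B) := by
    rw [injective_iff_map_eq_zero]
    intro p hp
    by_contra hp0
    let : Algebra k B := ((algebraMap k[X] B).comp C).toAlgebra
    have : IsScalarTower k k[X] B := .of_algebraMap_eq fun _ ↦ rfl
    have hX : IsIntegral k (algebraMap k[X] B X) := by
      rw [← isAlgebraic_iff_isIntegral]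
      refine ⟨p, hp0, ?_⟩
      rw [aeval_algebraMap_apply, aeval_X_left_apply, hp]
    have hall : ∀ q : k[X], IsIntegral k (algebraMap k[X] B q) := fun q ↦ by
      have : algebraMap k[X] B q = aeval (algebraMap k[X] B X) q := by
        rw [aeval_algebraMap_apply, aeval_X_left_apply]
      rw [this, aeval_eq_sum_range]
      exact IsIntegral.sum _ fun i _ ↦ (hX.pow i).smul _
    have hint : Algebra.IsIntegral k B := by
      refine ⟨fun b ↦ ?_⟩
      have hr : ((algebraMap k[X] B)).IsIntegralElem b := Algebra.IsIntegral.isIntegral b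
      let A' : Subalgebra k B := integralClosure k B
      obtain ⟨f, hf, hfb⟩ := hr
      let φ : k[X] →+* A' := (algebraMap k[X] B).codRestrict A' fun q ↦ hall q
      have : IsIntegral A' b := ⟨f.map φ, hf.map φ, by rw [eval₂_map]; exact hfb⟩
      exact isIntegral_trans b this
    have hfield : IsField B :=
      isField_of_isIntegral_of_isField' (R := k) (Field.toIsField k)
    let := hfield.toField
    exact hne ((RingHom.injective_iff_ker_eq_bot e).mp e.injective)
  have : Module.IsTorsionFree k[X] B := by
    have := (faithfulSMul_iff_algebraMap_injective k[X] B).mpr hinj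
    infer_instance
  have : Module.Free k[X] B := inferInstance
  -- The rank is computed in the fibre `k ⊗ B` over the image `c` of the point. Every `b` differs
  -- from the constant `e b` by an element of the ideal extended from `J`, and `J` vanishes at `c`,
  -- so `1 ⊗ 1` spans the fibre.
  have hle : Module.finrank k[X] B ≤ 1 := by
    let c := e (algebraMap k[X] B X)
    let : Algebra k[X] k := (evalRingHom c).toAlgebra
    have hev (p : k[X]) : e (algebraMap k[X] B p) = p.eval c := by
      have : e.comp (algebraMap k[X] B) = evalRingHom c := by
        refine Polynomial.ringHom_ext' ?_ ?_
        · rw [he]; ext; simp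
        · simp [c]
      exact congr($this p)
    rw [← Module.finrank_baseChange (R := k)]
    refine finrank_le_one ((1 : k) ⊗ₜ[k[X]] (1 : B)) fun w ↦ ?_
    have key (r : k) (p : k[X]) (b : B) : r ⊗ₜ[k[X]] (algebraMap k[X] B p * b) =
        (p.eval c * r) ⊗ₜ[k[X]] b := by
      rw [← Algebra.smul_def, TensorProduct.tmul_smul, TensorProduct.smul_tmul', Algebra.smul_def]
      rfl
    have hmem (r : k) (b : B) (hb : b ∈ J.map (algebraMap k[X] B)) : r ⊗ₜ[k[X]] b = 0 := by
      refine Submodule.closure_induction (p := fun b _ ↦ r ⊗ₜ[k[X]] b = 0) ?_ ?_ ?_ hb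
      · simp
      · intro x y _ _ hx hy
        rw [TensorProduct.tmul_add, hx, hy, add_zero]
      · rintro a _ ⟨p, hp, rfl⟩
        have h0 : e (algebraMap k[X] B p) = 0 := hJ.le (Ideal.mem_map_of_mem _ hp)
        rw [smul_eq_mul, mul_comm, key, ← hev, h0, zero_mul, TensorProduct.zero_tmul]
    induction w with
    | zero => exact ⟨0, by simp⟩
    | add x y hx hy =>
      obtain ⟨a, rfl⟩ := hx
      obtain ⟨b, rfl⟩ := hy
      exact ⟨a + b, add_smul _ _ _⟩
    | tmul r b =>
      refine ⟨e b * r, ?_⟩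
      have h := hmem r (b - algebraMap k[X] B (C (e b))) (by
        rw [hJ, RingHom.mem_ker, map_sub, he', sub_self])
      rw [TensorProduct.tmul_sub, sub_eq_zero] at h
      rw [h, ← mul_one (algebraMap k[X] B _), key, eval_C, TensorProduct.smul_tmul', smul_eq_mul,
        mul_one]
  refine Algebra.finrank_eq_one_iff_bijective_algebraMap.mp (le_antisymm hle ?_)
  exact Module.finrank_pos

end Algebra

/-! ### Fixed points of automorphisms of a proper rational curve -/

section FixedPoint

variable {k : Type u} [Field k]

/-- A rational function over an algebraically closed field has a fixed point: either a point `c` of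
the affine line, or the point at infinity. -/
theorem exists_fixed_point_of_fractionRing [IsAlgClosed k] (g : FractionRing k[X]) :
    ∃ p q : k[X], q ≠ 0 ∧ algebraMap k[X] (FractionRing k[X]) q * g = algebraMap k[X] _ p ∧
      ((∃ c, q.eval c ≠ 0 ∧ p.eval c = c * q.eval c) ∨ q.natDegree < p.natDegree) := by
  obtain ⟨p, ⟨q, hq⟩, hpq, rfl⟩ := IsFractionRing.exists_reduced_fraction (A := k[X]) g
  have hq0 : q ≠ 0 := nonZeroDivisors.ne_zero hq
  refine ⟨p, q, hq0, IsLocalization.mk'_spec' _ p ⟨q, hq⟩, ?_⟩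
  rw [or_iff_not_imp_right, not_lt]
  intro hdeg
  -- Without a pole at infinity, `X * q - p` has degree `q.natDegree + 1`, so it has a root;
  -- coprimality of `p` and `q` keeps the root away from the zeros of `q`.
  have hd : (X * q - p).degree ≠ 0 := by
    have h1 : (X * q).natDegree = q.natDegree + 1 := by rw [natDegree_X_mul hq0]
    rw [degree_sub_eq_left_of_degree_lt]
    · rw [degree_eq_natDegree (mul_ne_zero X_ne_zero hq0), h1]
      norm_cast
    · exact degree_lt_degree (by omega)
  obtain ⟨c, hc⟩ := IsAlgClosed.exists_root _ hd
  have hc' : p.eval c = c * q.eval c := by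
    rw [IsRoot, eval_sub, eval_mul, eval_X, sub_eq_zero] at hc
    exact hc.symm
  refine ⟨c, fun h0 ↦ ?_, hc'⟩
  have h1 : X - C c ∣ q := dvd_iff_isRoot.mpr h0
  have h2 : X - C c ∣ p := dvd_iff_isRoot.mpr (by rw [IsRoot, hc', h0, mul_zero])
  exact not_isUnit_X_sub_C c (hpq h2 h1)

variable {Y : Scheme.{u}}

theorem isDominant_SpecMap_of_injective {R K : Type u} [CommRing R] [CommRing K] (i : R →+* K)
    (hi : Function.Injective i) : IsDominant (Spec.map (CommRingCat.ofHom i)) :=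
  ⟨(PrimeSpectrum.denseRange_comap_iff_ker_le_nilRadical i).mpr
    (((RingHom.injective_iff_ker_eq_bot i).mp hi).le.trans bot_le)⟩

/-- Two morphisms from an integral affine scheme to a separated scheme agree if they agree at the
generic point. -/
theorem ext_of_SpecMap_injective {S : Scheme.{u}} (s : Y ⟶ S) [IsSeparated s]
    {R K : Type u} [CommRing R] [IsDomain R] [Field K] (i : R →+* K) (hi : Function.Injective i)
    {f g : Spec (.of R) ⟶ Y} (hs : f ≫ s = g ≫ s)
    (hfg : Spec.map (CommRingCat.ofHom i) ≫ f = Spec.map (CommRingCat.ofHom i) ≫ g) : f = g := by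
  have : IsDominant (Spec.map (CommRingCat.ofHom i)) := isDominant_SpecMap_of_injective i hi
  have : IsReduced (Spec (.of R)) := inferInstance
  exact ext_of_isDominant_of_isSeparated s hs _ hfg

/-- An endomorphism of an irreducible scheme with an open subscheme `𝔸¹` is given by a rational
function. -/
theorem exists_generic_SpecMap_comp [IrreducibleSpace Y] (τ : Y ⟶ Y) [Surjective τ]
    (j : Spec (.of k[X]) ⟶ Y) [IsOpenImmersion j] :
    ∃ ψ : k[X] →+* FractionRing k[X],
      Spec.map (CommRingCat.ofHom (algebraMap k[X] (FractionRing k[X]))) ≫ j ≫ τ =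
        Spec.map (CommRingCat.ofHom ψ) ≫ j := by
  set η : Spec (.of (FractionRing k[X])) ⟶ Spec (.of k[X]) :=
    Spec.map (CommRingCat.ofHom (algebraMap k[X] (FractionRing k[X])))
  have : IsDominant η := isDominant_SpecMap_of_injective _ (IsFractionRing.injective k[X] _)
  have hne : (j.opensRange : Set Y).Nonempty := ⟨_, ⟨⟨⊥, Ideal.isPrime_bot⟩, rfl⟩⟩
  have : IsDominant j := ⟨(j.opensRange.isOpen.dense hne)⟩
  have hdense := (η ≫ j).denseRange
  -- The generic point of the line lies in every nonempty open set, in particular in the preimage of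
  -- the line under the surjection `τ`.
  obtain ⟨y, hy⟩ := hdense.exists_mem_open (τ ⁻¹ᵁ j.opensRange).isOpen
    (hne.preimage τ.surjective)
  have hr : Set.range (η ≫ j ≫ τ) ⊆ Set.range j := by
    rintro _ ⟨z, rfl⟩
    have : z = y := Subsingleton.elim (α := PrimeSpectrum (FractionRing k[X])) _ _
    subst this
    rw [← Category.assoc, Scheme.Hom.comp_apply]
    exact hy
  refine ⟨(Spec.preimage (IsOpenImmersion.lift j _ hr)).hom, ?_⟩
  rw [CommRingCat.ofHom_hom, Spec.map_preimage, IsOpenImmersion.lift_fac]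

theorem pointOfLine_comp (h : Y ⟶ Spec (.of k)) (j : Spec (.of k[X]) ⟶ Y)
    (hj : j ≫ h = Spec.map (CommRingCat.ofHom C)) (c : k) :
    (Spec.map (CommRingCat.ofHom (evalRingHom c)) ≫ j) ≫ h = 𝟙 _ := by
  rw [Category.assoc, hj, ← Spec.map_comp, ← CommRingCat.ofHom_comp]
  have : (evalRingHom c).comp C = RingHom.id k := by ext; simp
  rw [this, CommRingCat.ofHom_id, Spec.map_id]

theorem comp_C_eq_of_generic (h : Y ⟶ Spec (.of k)) (τ : Y ⟶ Y) (hτ : τ ≫ h = h) (j : Spec (.of k[X]) ⟶ Y)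
    (hj : j ≫ h = Spec.map (CommRingCat.ofHom C))
    {K : Type u} [CommRing K] (ι ψ : k[X] →+* K)
    (hψ : Spec.map (CommRingCat.ofHom ι) ≫ j ≫ τ = Spec.map (CommRingCat.ofHom ψ) ≫ j) :
    ψ.comp C = ι.comp C := by
  have h1 := congr($hψ ≫ h)
  simp only [Category.assoc, hτ, hj] at h1
  rw [← Spec.map_comp, ← Spec.map_comp, ← CommRingCat.ofHom_comp, ← CommRingCat.ofHom_comp] at h1
  exact congr(($(Spec.map_injective h1)).hom).symm

/-- Over the locus where `q` is invertible, `j ≫ τ` is the map `p / q` into the line: the two agree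
generically, hence everywhere because `h` is separated. Evaluating at `c` then gives the fixed
point. -/
theorem exists_fixed_point_of_eval (h : Y ⟶ Spec (.of k)) [IsSeparated h] (τ : Y ⟶ Y) (hτ : τ ≫ h = h)
    (j : Spec (.of k[X]) ⟶ Y)
    (hj : j ≫ h = Spec.map (CommRingCat.ofHom C))
    (ψ : k[X] →+* FractionRing k[X])
    (hψ : Spec.map (CommRingCat.ofHom (algebraMap k[X] (FractionRing k[X]))) ≫ j ≫ τ =
        Spec.map (CommRingCat.ofHom ψ) ≫ j)
    (p q : k[X]) (hq : q ≠ 0)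
    (hpq : algebraMap k[X] (FractionRing k[X]) q * ψ X = algebraMap k[X] _ p)
    (c : k) (hc : q.eval c ≠ 0) (hpc : p.eval c = c * q.eval c) :
    ∃ z : Spec (.of k) ⟶ Y, z ≫ h = 𝟙 _ ∧ z ≫ τ = z := by
  refine ⟨Spec.map (CommRingCat.ofHom (evalRingHom c)) ≫ j, pointOfLine_comp h j hj c, ?_⟩
  let R := Localization.Away q
  have hψC := comp_C_eq_of_generic h τ hτ j hj _ _ hψ
  have hqu : IsUnit (algebraMap k[X] (FractionRing k[X]) q) :=
    ((map_ne_zero_iff _ (IsFractionRing.injective k[X] _)).mpr hq).isUnit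
  let ι : R →+* FractionRing k[X] := IsLocalization.Away.lift q hqu
  have hι : ι.comp (algebraMap k[X] R) = algebraMap k[X] _ := IsLocalization.Away.lift_comp q hqu
  have : IsDomain R := IsLocalization.isDomain_localization
    (powers_le_nonZeroDivisors_of_noZeroDivisors hq)
  have hιinj : Function.Injective ι := by
    refine (IsLocalization.lift_injective_iff _).mpr fun x y ↦ ?_
    rw [(IsLocalization.injective R (powers_le_nonZeroDivisors_of_noZeroDivisors hq)).eq_iff,
      (IsFractionRing.injective k[X] _).eq_iff]
  let ev : R →+* k := IsLocalization.Away.lift (g := evalRingHom c) q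
    (by simpa using hc)
  have hev : ev.comp (algebraMap k[X] R) = evalRingHom c := IsLocalization.Away.lift_comp q _
  let g : R := algebraMap k[X] R p * IsLocalization.Away.invSelf q
  have hg : algebraMap k[X] R q * g = algebraMap k[X] R p := by
    rw [mul_left_comm, IsLocalization.Away.mul_invSelf, mul_one]
  let θ : k[X] →+* R := eval₂RingHom ((algebraMap k[X] R).comp C) g
  have hθ : ι.comp θ = ψ := by
    refine Polynomial.ringHom_ext' ?_ ?_
    · rw [hψC, ← hι]
      ext; simp [θ]
    · have := congr(ι $hg)
      rw [map_mul, ← RingHom.comp_apply, ← RingHom.comp_apply, hι, ← hpq] at this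
      simpa [θ] using mul_left_cancel₀ hqu.ne_zero this
  have hevθ : ev.comp θ = evalRingHom c := by
    refine Polynomial.ringHom_ext' ?_ ?_
    · rw [← hev]
      ext; simp [θ]
    · have := congr(ev $hg)
      rw [map_mul, ← RingHom.comp_apply, ← RingHom.comp_apply, hev, coe_evalRingHom,
        hpc, mul_comm c] at this
      simpa [θ] using mul_left_cancel₀ hc this
  have key : Spec.map (CommRingCat.ofHom (algebraMap k[X] R)) ≫ j ≫ τ =
      Spec.map (CommRingCat.ofHom θ) ≫ j := by
    refine ext_of_SpecMap_injective h ι hιinj ?_ ?_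
    · simp only [Category.assoc, hτ, hj]
      rw [← Spec.map_comp, ← Spec.map_comp, ← CommRingCat.ofHom_comp, ← CommRingCat.ofHom_comp]
      congr 2
      ext; simp [θ]
    · rw [← Spec.map_comp_assoc, ← Spec.map_comp_assoc, ← CommRingCat.ofHom_comp,
        ← CommRingCat.ofHom_comp, hι, hθ, hψ]
  have := congr(Spec.map (CommRingCat.ofHom ev) ≫ $key)
  rw [← Spec.map_comp_assoc, ← Spec.map_comp_assoc, ← CommRingCat.ofHom_comp,
    ← CommRingCat.ofHom_comp, hev, hevθ] at this
  rw [Category.assoc, this]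

/-! ### The local ring at infinity, with parameter `t = 1 / x` -/

section Infinity

theorem isPrime_span_X : (Ideal.span {(X : k[X])}).IsPrime :=
  (Ideal.span_singleton_prime X_ne_zero).mpr prime_X

attribute [local instance] isPrime_span_X

variable (R : Type u) [CommRing R] [Algebra k[X] R]
  [IsLocalization.AtPrime R (Ideal.span {(X : k[X])})]

theorem algebraMap_localization_span_X_injective :
    Function.Injective (algebraMap k[X] R) :=
  IsLocalization.injective R (Ideal.span {(X : k[X])}).primeCompl_le_nonZeroDivisors

/-- Evaluation at the origin, on the local ring of the affine line. -/
theorem exists_evalOrigin : ∃ ev : R →+* k, ev.comp (algebraMap k[X] R) = evalRingHom 0 ∧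
    ∀ a, ev a ≠ 0 → IsUnit a := by
  have hu (y : (Ideal.span {(X : k[X])}).primeCompl) : IsUnit (evalRingHom 0 (y : k[X])) := by
    have := y.2
    rw [Ideal.mem_primeCompl_iff, Ideal.mem_span_singleton, X_dvd_iff,
      coeff_zero_eq_eval_zero] at this
    exact isUnit_iff_ne_zero.mpr this
  let ev : R →+* k := IsLocalization.lift hu
  have hev : ev.comp (algebraMap k[X] R) = evalRingHom 0 := IsLocalization.lift_comp _
  have := IsLocalization.AtPrime.isLocalRing R (Ideal.span {(X : k[X])})
  refine ⟨ev, hev, fun a ha ↦ ?_⟩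
  by_contra hu
  have hsurj : Function.Surjective ev := fun c ↦ ⟨algebraMap k[X] R (C c), by
    rw [← RingHom.comp_apply, hev]; simp⟩
  have hm := IsLocalRing.eq_maximalIdeal (RingHom.ker_isMaximal_of_surjective ev hsurj)
  have : a ∈ RingHom.ker ev := hm ▸ (IsLocalRing.mem_maximalIdeal a).mpr hu
  exact ha this

section FractionField

variable (K : Type u) [Field K] [Algebra R K] [IsFractionRing R K]

/-- The inclusion of polynomials in the function field of the line, with coordinate the inverse
of the parameter at infinity. -/
noncomputable def invCoord : k[X] →+* K :=
  eval₂RingHom (((algebraMap R K).comp (algebraMap k[X] R)).comp C)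
    (algebraMap R K (algebraMap k[X] R X))⁻¹

theorem algebraMap_X_ne_zero : algebraMap R K (algebraMap k[X] R X) ≠ 0 := by
  rw [map_ne_zero_iff _ (IsFractionRing.injective R K),
    map_ne_zero_iff _ (algebraMap_localization_span_X_injective R)]
  exact X_ne_zero

theorem invCoord_mul_pow (p : k[X]) :
    invCoord R K p * algebraMap R K (algebraMap k[X] R X) ^ p.natDegree =
      algebraMap R K (algebraMap k[X] R p.reverse) := by
  have h0 := algebraMap_X_ne_zero (k := k) R K
  let : Invertible (algebraMap R K (algebraMap k[X] R X))⁻¹ := invertibleOfNonzero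
    (inv_ne_zero h0)
  have := eval₂_reverse_mul_pow (((algebraMap R K).comp (algebraMap k[X] R)).comp C)
    (algebraMap R K (algebraMap k[X] R X))⁻¹ p
  rw [invOf_eq_inv, inv_inv] at this
  rw [invCoord, coe_eval₂RingHom, ← this, mul_assoc, ← mul_pow, inv_mul_cancel₀ h0, one_pow,
    mul_one]
  conv_rhs => rw [← eval₂_C_X (p := p.reverse), hom_eval₂, hom_eval₂]
  rfl

theorem invCoord_injective : Function.Injective (invCoord (k := k) R K) := by
  rw [injective_iff_map_eq_zero]
  intro p hp
  have := invCoord_mul_pow R K p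
  rw [hp, zero_mul, eq_comm, map_eq_zero_iff _ (IsFractionRing.injective R K),
    map_eq_zero_iff _ (algebraMap_localization_span_X_injective R)] at this
  exact reverse_eq_zero.mp this

/-- A rational function `p / q` with a pole at infinity induces an endomorphism of the local ring
at infinity. -/
theorem exists_endomorphism_of_natDegree_lt [IsDomain R] (p q : k[X]) (hq : q ≠ 0)
    (hdeg : q.natDegree < p.natDegree) :
    ∃ θ : R →+* R, Function.Injective θ ∧
      (θ.comp (algebraMap k[X] R)).comp C = (algebraMap k[X] R).comp C ∧
      invCoord R K p * algebraMap R K (θ (algebraMap k[X] R X)) = invCoord R K q ∧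
      ∀ ev : R →+* k, ev.comp (algebraMap k[X] R) = evalRingHom 0 → ev.comp θ = ev := by
  obtain ⟨ev, hev, hunit⟩ := exists_evalOrigin (k := k) R
  have hev' (f : k[X]) : ev (algebraMap k[X] R f) = f.eval 0 := congr($hev f)
  have hp : p ≠ 0 := by rintro rfl; simp at hdeg
  have hpu : IsUnit (algebraMap k[X] R p.reverse) := hunit _ (by
    rw [hev', ← coeff_zero_eq_eval_zero, coeff_zero_reverse]
    exact leadingCoeff_ne_zero.mpr hp)
  obtain ⟨v, hv⟩ := hpu.exists_right_inv
  -- This is `q(1/t) / p(1/t)`, the inverse of `g` in the parameter at infinity. The power of `t`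
  -- has positive exponent by `hdeg`, so `w` vanishes at the origin.
  let w : R := algebraMap k[X] R (X ^ (p.natDegree - q.natDegree) * q.reverse) * v
  have hw0 : w ≠ 0 := by
    refine mul_ne_zero ?_ (right_ne_zero_of_mul_eq_one hv)
    rw [map_ne_zero_iff _ (algebraMap_localization_span_X_injective R)]
    exact mul_ne_zero (pow_ne_zero _ X_ne_zero) (reverse_eq_zero.not.mpr hq)
  have hevw (ev : R →+* k) (hev : ev.comp (algebraMap k[X] R) = evalRingHom 0) : ev w = 0 := by
    rw [map_mul, ← RingHom.comp_apply, hev]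
    simp [Nat.sub_ne_zero_of_lt hdeg]
  let θ₀ : k[X] →+* R := eval₂RingHom ((algebraMap k[X] R).comp C) w
  have hevθ₀ (ev : R →+* k) (hev : ev.comp (algebraMap k[X] R) = evalRingHom 0) :
      ev.comp θ₀ = evalRingHom 0 := by
    refine Polynomial.ringHom_ext' ?_ ?_
    · rw [← hev]
      ext; simp [θ₀]
    · simp [θ₀, hevw ev hev]
  have hu (y : (Ideal.span {(X : k[X])}).primeCompl) : IsUnit (θ₀ y) := by
    have := y.2
    rw [Ideal.mem_primeCompl_iff, Ideal.mem_span_singleton, X_dvd_iff,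
      coeff_zero_eq_eval_zero] at this
    refine hunit _ ?_
    rw [← RingHom.comp_apply, hevθ₀ ev hev]
    exact this
  let θ : R →+* R := IsLocalization.lift hu
  have hθ : θ.comp (algebraMap k[X] R) = θ₀ := IsLocalization.lift_comp _
  have hθX : θ (algebraMap k[X] R X) = w := by
    rw [← RingHom.comp_apply, hθ]; simp [θ₀]
  refine ⟨θ, ?_, ?_, ?_, fun ev hev ↦ ?_⟩
  -- A nonzero prime kernel would be the maximal ideal and so contain `t`, but `t` maps to `w ≠ 0`.
  · have := IsLocalization.AtPrime.isLocalRing R (Ideal.span {(X : k[X])})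
    have : IsDedekindDomain R :=
      IsLocalization.isDedekindDomain k[X]
        (Ideal.span {(X : k[X])}).primeCompl_le_nonZeroDivisors R
    rw [RingHom.injective_iff_ker_eq_bot]
    by_contra hne
    have hm := IsLocalRing.eq_maximalIdeal ((RingHom.ker_isPrime θ).isMaximal hne)
    have : algebraMap k[X] R X ∈ RingHom.ker θ := by
      rw [hm, IsLocalRing.mem_maximalIdeal]
      intro h
      have := h.map ev
      rw [hev'] at this
      simp at this
    exact hw0 (hθX ▸ this)
  · rw [hθ]; ext; simp [θ₀]
  · have h0 := algebraMap_X_ne_zero (k := k) R K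
    refine mul_right_cancel₀ (pow_ne_zero p.natDegree h0) ?_
    rw [mul_right_comm, invCoord_mul_pow, hθX]
    obtain ⟨n, hn⟩ := Nat.exists_eq_add_of_le' hdeg.le
    rw [show w = algebraMap k[X] R (X ^ n * q.reverse) * v by simp [w, hn], hn,
      pow_add, mul_left_comm, invCoord_mul_pow, ← map_pow, ← map_mul, ← map_mul, ← map_pow,
      ← map_mul]
    congr 1
    rw [mul_left_comm, hv, mul_one]
  · refine IsLocalization.ringHom_ext (Ideal.span {(X : k[X])}).primeCompl ?_
    rw [RingHom.comp_assoc, hθ, hevθ₀ ev hev, hev]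

end FractionField

/-- By properness the generic point of the line extends to `ℓ : Spec R ⟶ Y` across `t = 0`. The
endomorphism `θ` of `R` is `τ` read along `ℓ`, by separatedness, and it fixes the closed point; so
`τ` fixes the image of that point, whether or not `Y` is regular there. -/
theorem exists_fixed_point_of_pole_at_infty [IsDomain R] {Y : Scheme.{u}} (h : Y ⟶ Spec (.of k)) [IsProper h]
    (τ : Y ⟶ Y) (hτ : τ ≫ h = h) (j : Spec (.of k[X]) ⟶ Y)
    (hj : j ≫ h = Spec.map (CommRingCat.ofHom C)) (ψ : k[X] →+* FractionRing k[X])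
    (hψ : Spec.map (CommRingCat.ofHom (algebraMap k[X] (FractionRing k[X]))) ≫ j ≫ τ =
        Spec.map (CommRingCat.ofHom ψ) ≫ j)
    (p q : k[X]) (hq : q ≠ 0)
    (hpq : algebraMap k[X] (FractionRing k[X]) q * ψ X = algebraMap k[X] _ p)
    (hdeg : q.natDegree < p.natDegree) :
    ∃ z : Spec (.of k) ⟶ Y, z ≫ h = 𝟙 _ ∧ z ≫ τ = z := by
  have hψC := comp_C_eq_of_generic h τ hτ j hj _ _ hψ
  have : IsDiscreteValuationRing R :=
    IsLocalization.AtPrime.isDiscreteValuationRing_of_dedekind_domain k[X]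
      (P := Ideal.span {(X : k[X])}) (by simp) R
  let K := FractionRing R
  obtain ⟨θ, hθinj, hθC, hθX, hθev⟩ := exists_endomorphism_of_natDegree_lt R K p q hq hdeg
  obtain ⟨ev, hev, -⟩ := exists_evalOrigin (k := k) R
  let β : k[X] →+* K := invCoord R K
  let β' : FractionRing k[X] →+* K := IsFractionRing.lift (invCoord_injective (k := k) R K)
  have hβ' (f : k[X]) : β' (algebraMap k[X] _ f) = β f := IsFractionRing.lift_algebraMap _ f
  have hβC : β.comp C = ((algebraMap R K).comp (algebraMap k[X] R)).comp C := by
    ext; simp [β, invCoord]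
  have hinj : Function.Injective ((algebraMap R K).comp θ) :=
    (IsFractionRing.injective R K).comp hθinj
  let θ' : K →+* K := IsFractionRing.lift hinj
  have hθ' (f : R) : θ' (algebraMap R K f) = algebraMap R K (θ f) :=
    IsFractionRing.lift_algebraMap hinj f
  -- Both sides are `k`-linear and send the coordinate to `g(1/t)`.
  have hcomm : θ'.comp β = β'.comp ψ := by
    refine Polynomial.ringHom_ext' ?_ ?_
    · rw [RingHom.comp_assoc, RingHom.comp_assoc, hψC, hβC]
      ext a
      simp only [RingHom.comp_apply, hβ', hθ']
      rw [← RingHom.comp_apply β, hβC]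
      exact congr(algebraMap R K ($hθC a))
    · have h1 : β q * β' (ψ X) = β p := by rw [← hβ', ← map_mul, hpq, hβ']
      have hβq : β q ≠ 0 := (map_ne_zero_iff _ (invCoord_injective (k := k) R K)).mpr hq
      have h2 : θ' (β X) = (algebraMap R K (θ (algebraMap k[X] R X)))⁻¹ := by
        simp [β, invCoord, hθ']
      have h3 : algebraMap R K (θ (algebraMap k[X] R X)) ≠ 0 := by
        intro h0
        rw [h0, mul_zero] at hθX
        exact hβq hθX.symm
      rw [RingHom.comp_apply, RingHom.comp_apply, h2, inv_eq_iff_eq_inv]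
      refine eq_inv_of_mul_eq_one_left (mul_left_cancel₀ hβq ?_)
      rw [mul_left_comm, h1, mul_comm, mul_one]
      exact hθX
  let S : ValuativeCommSq h :=
    { R := R
      K := K
      i₁ := Spec.map (CommRingCat.ofHom β) ≫ j
      i₂ := Spec.map (CommRingCat.ofHom ((algebraMap k[X] R).comp C))
      commSq := ⟨by
        rw [Category.assoc, hj, ← Spec.map_comp, ← Spec.map_comp, ← CommRingCat.ofHom_comp,
          ← CommRingCat.ofHom_comp, hβC, RingHom.comp_assoc]⟩ }
  have hval : ValuativeCriterion.Existence h :=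
    ((UniversallyClosed.eq_valuativeCriterion ▸ ‹IsProper h›.toUniversallyClosed :
      (ValuativeCriterion.Existence ⊓ @QuasiCompact : MorphismProperty Scheme) h)).1
  obtain ⟨⟨ℓ, hℓ₁, hℓ₂⟩⟩ := hval S
  have key : ℓ ≫ τ = Spec.map (CommRingCat.ofHom θ) ≫ ℓ := by
    refine ext_of_SpecMap_injective h (algebraMap R K) (IsFractionRing.injective R K) ?_ ?_
    · rw [Category.assoc, Category.assoc, hτ, hℓ₂]
      simp only [S]
      rw [← Spec.map_comp, ← CommRingCat.ofHom_comp, ← RingHom.comp_assoc, hθC]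
    · have e1 : (algebraMap R K).comp θ = θ'.comp (algebraMap R K) := by
        ext r; exact (hθ' r).symm
      have e2 : β = β'.comp (algebraMap k[X] _) := RingHom.ext fun f ↦ (hβ' f).symm
      rw [← Category.assoc, hℓ₁, ← Spec.map_comp_assoc, ← CommRingCat.ofHom_comp, e1,
        CommRingCat.ofHom_comp, Spec.map_comp_assoc, hℓ₁]
      simp only [S]
      rw [← Spec.map_comp_assoc, ← CommRingCat.ofHom_comp, hcomm, CommRingCat.ofHom_comp,
        Spec.map_comp_assoc, ← hψ, ← Spec.map_comp_assoc, ← CommRingCat.ofHom_comp, ← e2,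
        Category.assoc]
  refine ⟨Spec.map (CommRingCat.ofHom ev) ≫ ℓ, ?_, ?_⟩
  · rw [Category.assoc, hℓ₂]
    simp only [S]
    rw [← Spec.map_comp, ← CommRingCat.ofHom_comp, ← RingHom.comp_assoc, hev]
    have : (evalRingHom 0).comp C = RingHom.id k := by ext; simp
    rw [this, CommRingCat.ofHom_id, Spec.map_id]
  · rw [Category.assoc, key, ← Spec.map_comp_assoc, ← CommRingCat.ofHom_comp, hθev ev hev]

end Infinity

/-- Every automorphism of a proper rational curve over an algebraically closed field has a fixed
rational point. -/
theorem exists_fixed_point [IsAlgClosed k] {Y : Scheme.{u}} [IrreducibleSpace Y]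
    (h : Y ⟶ Spec (.of k)) [IsProper h] (τ : Y ⟶ Y) [Surjective τ] (hτ : τ ≫ h = h)
    (j : Spec (.of k[X]) ⟶ Y) [IsOpenImmersion j]
    (hj : j ≫ h = Spec.map (CommRingCat.ofHom C)) :
    ∃ z : Spec (.of k) ⟶ Y, z ≫ h = 𝟙 _ ∧ z ≫ τ = z := by
  obtain ⟨ψ, hψ⟩ := exists_generic_SpecMap_comp τ j
  obtain ⟨p, q, hq, hpq, ⟨c, hc, hpc⟩ | hdeg⟩ := exists_fixed_point_of_fractionRing (ψ X)
  · exact exists_fixed_point_of_eval h τ hτ j hj ψ hψ p q hq hpq c hc hpc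
  · have := isPrime_span_X (k := k)
    have : IsDomain (Localization.AtPrime (Ideal.span {(X : k[X])})) :=
      IsLocalization.isDomain_localization (Ideal.primeCompl_le_nonZeroDivisors _)
    exact exists_fixed_point_of_pole_at_infty (Localization.AtPrime (Ideal.span {(X : k[X])})) h τ hτ j hj ψ hψ p q hq hpq hdeg

open MonoidalCategory CartesianMonoidalCategory MonObj in
/-- A proper irreducible group scheme over an algebraically closed field does not contain the affine
line as an open subscheme. -/
theorem not_isOpenImmersion_of_grpObj [IsAlgClosed k] (G : Over (Spec (CommRingCat.of k)))
    [GrpObj G] [IsProper G.hom] [IrreducibleSpace G.left] (j : Spec (.of k[X]) ⟶ G.left)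
    (hj : j ≫ G.hom = Spec.map (CommRingCat.ofHom C)) : ¬ IsOpenImmersion j := by
  intro hopen
  let P (c : k) : 𝟙_ (Over (Spec (CommRingCat.of k))) ⟶ G :=
    Over.homMk (Spec.map (CommRingCat.ofHom (evalRingHom c)) ≫ j) (pointOfLine_comp G.hom j hj c)
  -- Two distinct points of the line give a nontrivial translation; a fixed point would force `a =
  -- 1`.
  let a := P 1 * (P 0)⁻¹
  let τ : G ≅ G := GrpObj.mulRight a
  have : IsIso τ.hom.left := inferInstanceAs (IsIso ((Over.forget _).map τ.hom))
  have : Surjective τ.hom.left := inferInstance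
  obtain ⟨z, hz, hzτ⟩ := exists_fixed_point G.hom τ.hom.left (Over.w τ.hom) j hj
  let z' : 𝟙_ (Over (Spec (CommRingCat.of k))) ⟶ G := Over.homMk z hz
  have h1 : z' ≫ τ.hom = z' := by ext1; exact hzτ
  have h2 : z' ≫ τ.hom = z' * a := by
    simp [τ, Hom.mul_def, comp_lift_assoc]
  have ha : a = 1 := by rwa [h2, mul_eq_left] at h1
  have hP : P 1 = P 0 := mul_inv_eq_one.mp ha
  have h3 : Spec.map (CommRingCat.ofHom (evalRingHom (1 : k))) ≫ j =
      Spec.map (CommRingCat.ofHom (evalRingHom 0)) ≫ j := congr(($hP).left)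
  rw [cancel_mono] at h3
  have h4 := congr(($(Spec.map_injective h3)).hom X)
  simp at h4

end FixedPoint

/-! ### An étale coordinate centred at a rational point -/

section EtaleCoordinate

variable {k : Type u} [Field k]

theorem algebraMap_mem_nonZeroDivisors_of_flat {A B : Type*} [CommRing A] [CommRing B]
    [Algebra A B] [Module.Flat A B] {a : A} (ha : a ∈ nonZeroDivisors A) :
    algebraMap A B a ∈ nonZeroDivisors B := by
  refine mem_nonZeroDivisors_iff_right.mpr fun b hb ↦
    Module.Flat.isSMulRegular_of_nonZeroDivisors ha (M := B) ?_
  simpa [Algebra.smul_def, mul_comm] using hb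

/-- Around a rational point of an étale algebra over the affine line, a suitable translate of the
coordinate generates the ideal of the point. -/
theorem exists_etale_coordinate {R₀ A : Type u} [CommRing R₀] [CommRing A] (κ : k →+* R₀)
    (hκ : Function.Bijective κ) (g : MvPolynomial (Fin 1) R₀ →+* A) (hg : g.Etale)
    (e : A →+* k) (he : ((e.comp g).comp MvPolynomial.C).comp κ = RingHom.id k) :
    ∃ (s : A) (φ : k[X] →+* Localization.Away s) (e' : Localization.Away s →+* k),
      φ.Etale ∧ φ.comp C = (algebraMap A (Localization.Away s)).comp
        ((g.comp MvPolynomial.C).comp κ) ∧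
      e'.comp (algebraMap A _) = e ∧ RingHom.ker e' = Ideal.span {φ X} ∧
      φ X ∈ nonZeroDivisors (Localization.Away s) := by
  let c := e (g (MvPolynomial.X 0))
  -- The shift by `-c` moves the image of the point to the origin.
  let e₁ : k[X] ≃+* MvPolynomial (Fin 1) R₀ :=
    ((algEquivAevalXAddC (-c)).toRingEquiv.trans
      (MvPolynomial.uniqueAlgEquiv k (Fin 1)).symm.toRingEquiv).trans
      (MvPolynomial.mapEquiv (Fin 1) (RingEquiv.ofBijective κ hκ))
  let β : k[X] →+* MvPolynomial (Fin 1) R₀ := e₁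
  have hβ : Function.Bijective β := e₁.bijective
  have hβC : β.comp C = MvPolynomial.C.comp κ := by
    ext a
    simp [β, e₁]
  have hβX : β X = MvPolynomial.X 0 - MvPolynomial.C (κ c) := by
    simp [β, e₁, sub_eq_add_neg]
  let φ₀ : k[X] →+* A := g.comp β
  have hφ₀ : φ₀.Etale := RingHom.Etale.stableUnderComposition _ _ (.of_bijective hβ) hg
  let : Algebra k[X] A := φ₀.toAlgebra
  have : Algebra.Etale k[X] A := hφ₀
  have heX : e (φ₀ X) = 0 := by
    have : e (g (MvPolynomial.C (κ c))) = c := congr($he c)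
    simp only [φ₀, RingHom.comp_apply, hβX, map_sub, this]
    exact sub_self c
  obtain ⟨s, hs, hspan⟩ := exists_mul_mem_span_of_etale e heX
  let R := Localization.Away s
  let φ : k[X] →+* R := algebraMap k[X] R
  have hφA : φ = (algebraMap A R).comp φ₀ := IsScalarTower.algebraMap_eq k[X] A R
  have : Algebra.Etale A R := .of_isLocalizationAway s
  have hφ : Algebra.Etale k[X] R := .comp k[X] A R
  let e' : R →+* k := IsLocalization.Away.lift s hs.isUnit
  have he' : e'.comp (algebraMap A R) = e := IsLocalization.Away.lift_comp s _
  refine ⟨s, φ, e', RingHom.etale_algebraMap.mpr hφ, ?_, he', le_antisymm ?_ ?_, ?_⟩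
  · simp only [hφA, φ₀, RingHom.comp_assoc, hβC]
    rfl
  · intro r hr
    obtain ⟨⟨a, ⟨_, n, rfl⟩⟩, hra⟩ := IsLocalization.surj (Submonoid.powers s) r
    have hea : e a = 0 := by
      rw [← he', RingHom.comp_apply, ← hra, map_mul, RingHom.mem_ker.mp hr, zero_mul]
    obtain ⟨b, hb⟩ := Ideal.mem_span_singleton'.mp (hspan a hea)
    have hsu : IsUnit (algebraMap A R s) := IsLocalization.Away.algebraMap_isUnit s
    -- In the exponent `n + 1`, `n` factors clear the denominator of `r` and one more brings the
    -- numerator into the ideal generated by the coordinate.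
    rw [← Ideal.mul_unit_mem_iff_mem _ (hsu.pow (n + 1)), pow_succ, ← mul_assoc, ← map_pow, hra,
      ← map_mul, mul_comm a, ← hb, map_mul]
    exact Ideal.mul_mem_left _ _ (Ideal.mem_span_singleton_self _)
  · rw [Ideal.span_singleton_le_iff_mem, RingHom.mem_ker, hφA, RingHom.comp_apply,
      ← RingHom.comp_apply e', he', heX]
  · have : Module.Flat k[X] R := inferInstance
    exact algebraMap_mem_nonZeroDivisors_of_flat
      (mem_nonZeroDivisors_of_ne_zero (X_ne_zero : (X : k[X]) ≠ 0))

end EtaleCoordinate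

/-! ### Ideal sheaves of closed points as kernels of evaluation -/

section ClosedPoint

variable {k : Type u} [Field k] {Y : Scheme.{u}}

theorem closedPoint_eq_ker (x : Y) (hx : IsClosed ({x} : Set Y)) (p : Spec (.of k) ⟶ Y)
    (hp : ∀ a, p a = x) : closedPoint x hx = p.ker := by
  have : IsReduced (Spec (.of k)) := inferInstance
  rw [← Scheme.IdealSheafData.map_bot, ← Scheme.nilradical_eq_bot,
    ← Scheme.IdealSheafData.vanishingIdeal_top, Scheme.IdealSheafData.map_vanishingIdeal,
    closedPoint]
  congr 1
  ext1
  have : p '' (⊤ : TopologicalSpace.Closeds (Spec (.of k))) = {x} := by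
    ext y
    constructor
    · rintro ⟨a, -, rfl⟩; exact hp a
    · rintro rfl; exact ⟨IsLocalRing.closedPoint k, trivial, hp _⟩
  rw [TopologicalSpace.Closeds.coe_closure, this, hx.closure_eq]
  rfl

theorem closedPointOn_eq_ker (x : Y) (hx : IsClosed ({x} : Set Y)) (p : Spec (.of k) ⟶ Y)
    [IsClosedImmersion p] (hp : ∀ a, p a = x) (U : Y.Opens) (q : Spec (.of k) ⟶ U.toScheme)
    (hq : q ≫ U.ι = p) : closedPointOn x hx U = q.ker := by
  rw [closedPointOn, closedPoint_eq_ker x hx p hp, ← Scheme.IdealSheafData.ker_fst_of_isClosedImmersion]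
  have H : IsPullback q (𝟙 _) U.ι p := by
    have hr : Set.range p ⊆ Set.range U.ι := by
      rw [← hq, Scheme.Hom.comp_base, TopCat.coe_comp]; exact Set.range_comp_subset_range _ _
    have : q = IsOpenImmersion.lift U.ι p hr := IsOpenImmersion.lift_uniq _ _ _ _ hq
    rw [this]
    exact IsOpenImmersion.isPullback_lift_id p U.ι hr
  rw [← H.isoPullback_hom_fst, Scheme.Hom.ker_comp_of_isIso]

/-- The adjunction between `comap` and `map` of ideal sheaves shows that both sides have the same
upper bounds. -/
theorem comap_ideal_top {Z W : Scheme.{u}} [IsAffine Z] [IsAffine W] (f : Z ⟶ W)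
    (I : W.IdealSheafData) :
    (I.comap f).ideal ⟨⊤, isAffineOpen_top Z⟩ =
      (I.ideal ⟨⊤, isAffineOpen_top W⟩).map f.appTop.hom := by
  have key (J : Z.IdealSheafData) : I.comap f ≤ J ↔
      (I.ideal ⟨⊤, isAffineOpen_top W⟩).map f.appTop.hom ≤ J.ideal ⟨⊤, isAffineOpen_top Z⟩ := by
    rw [← Scheme.IdealSheafData.le_map_iff_comap_le, Ideal.map_le_iff_le_comap]
    have : (J.map f).ideal ⟨⊤, isAffineOpen_top W⟩ =
      (J.ideal ⟨⊤, isAffineOpen_top Z⟩).comap f.appTop.hom :=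
      Scheme.IdealSheafData.ideal_map_of_isAffineHom J f ⟨⊤, isAffineOpen_top W⟩
    rw [← this]
    exact ⟨fun h ↦ h _, Scheme.IdealSheafData.le_of_isAffine⟩
  apply le_antisymm
  · have := (key (Scheme.IdealSheafData.ofIdealTop
      ((I.ideal ⟨⊤, isAffineOpen_top W⟩).map f.appTop.hom))).mpr (by simp)
    simpa using this ⟨⊤, isAffineOpen_top Z⟩
  · exact (key _).mp le_rfl

end ClosedPoint

/-! ### Passing from rings to schemes -/

section Main

variable {k : Type u} [Field k]

theorem IsEllipticCurve.isIntegral {X : Over (Spec (CommRingCat.of k))}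
    (hX : IsEllipticCurve X) : IsIntegral X.left := by
  have := hX.geometricallyIntegral
  have : Subsingleton (Spec (CommRingCat.of k)) :=
    inferInstanceAs (Subsingleton (PrimeSpectrum k))
  exact GeometricallyIntegral.isIntegral_of_subsingleton X.hom

/-- A coordinate on the affine line pulls back to the defining ring homomorphism. -/
theorem SpecMap_comp_SpecIso_inv {R : Type u} [CommRing R] (φ : k →+* R) (t : R) :
    AffineSpace.homOfVector (n := PUnit.{u + 1}) (Spec.map (CommRingCat.ofHom φ))
        (fun _ ↦ (Scheme.ΓSpecIso (.of R)).inv t) =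
      Spec.map (CommRingCat.ofHom (MvPolynomial.eval₂Hom φ fun _ ↦ t)) ≫
        (AffineSpace.SpecIso PUnit.{u + 1} (.of k)).inv := by
  refine AffineSpace.hom_ext ?_ fun i ↦ ?_
  · rw [AffineSpace.homOfVector_over, Category.assoc, AffineSpace.SpecIso_inv_over,
      ← Spec.map_comp, ← CommRingCat.ofHom_comp]
    congr 2
    ext a; simp
  · rw [AffineSpace.homOfVector_appTop_coord, Scheme.Hom.comp_appTop, CommRingCat.comp_apply,
      AffineSpace.SpecIso_inv_appTop_coord, ← CommRingCat.comp_apply,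
      ← Scheme.ΓSpecIso_inv_naturality, CommRingCat.comp_apply]
    simp

theorem isSpecialNeighbourhood_of_openImmersion (X : Over (Spec (CommRingCat.of k)))
    (x : X.left) (hx : IsClosed ({x} : Set X.left)) {R : Type u} [CommRing R]
    (j : Spec (.of R) ⟶ X.left) [IsOpenImmersion j] (φ : k[X] →+* R) (hφ : φ.Etale)
    (hj : j ≫ X.hom = Spec.map (CommRingCat.ofHom (φ.comp C)))
    (ht : φ Polynomial.X ∈ nonZeroDivisors R) (e : R →+* k) (he : RingHom.ker e = Ideal.span {φ Polynomial.X})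
    [IsClosedImmersion (Spec.map (CommRingCat.ofHom e) ≫ j)]
    (hex : ∀ a, (Spec.map (CommRingCat.ofHom e) ≫ j) a = x) :
    ∃ (U : X.left.Opens) (u : Γ(U.toScheme, ⊤)), IsSpecialNeighbourhood X x hx U u := by
  let U := j.opensRange
  let i : Spec (.of R) ≅ U.toScheme := j.isoOpensRange
  have hi : i.hom ≫ U.ι = j := j.isoOpensRange_hom_ι
  let ρ : Γ(U.toScheme, ⊤) ≃+* R :=
    (Scheme.Γ.mapIso i.op ≪≫ Scheme.ΓSpecIso (.of R)).commRingCatIsoToRingEquiv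
  let u : Γ(U.toScheme, ⊤) := ρ.symm (φ Polynomial.X)
  have : IsAffine U.toScheme := .of_isIso i.inv
  refine ⟨U, u, isAffineOpen_opensRange j, ?_, ?_, ?_, ?_⟩
  · have := hex (IsLocalRing.closedPoint k)
    exact ⟨_, this⟩
  · rw [mem_nonZeroDivisors_iff_right] at ht ⊢
    intro a ha
    have := ht (ρ a) (by rw [← map_zero ρ, ← ha, map_mul]; simp [u])
    simpa using this
  · rw [closedPointOn_eq_ker x hx _ hex U (Spec.map (CommRingCat.ofHom e) ≫ i.hom)
      (by rw [Category.assoc, hi]), Scheme.ker_of_isAffine]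
    congr 1
    have h1 (a : Γ(U.toScheme, ⊤)) : (Scheme.ΓSpecIso (.of k)).hom
        ((Spec.map (CommRingCat.ofHom e) ≫ i.hom).appTop a) = e (ρ a) :=
      congr($(Scheme.ΓSpecIso_naturality (CommRingCat.ofHom e)) (i.hom.appTop a))
    have h2 (a : Γ(U.toScheme, ⊤)) :
        (Spec.map (CommRingCat.ofHom e) ≫ i.hom).appTop a = 0 ↔ e (ρ a) = 0 := by
      rw [← h1]
      exact (map_eq_zero_iff _ (ConcreteCategory.bijective_of_isIso
        (Scheme.ΓSpecIso (.of k)).hom).1).symm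
    ext a
    rw [RingHom.mem_ker]
    refine (h2 a).trans ?_
    rw [← RingHom.mem_ker, he, Ideal.mem_span_singleton, Ideal.mem_span_singleton,
      ← map_dvd_iff ρ.symm, ρ.symm_apply_apply]
  -- The coordinate is étale on all of `U`, including at `x`; restriction to the open complement
  -- preserves this.
  · have : Etale (toAffineLine X U u) := by
      have : MorphismProperty.RespectsIso (@Etale.{u}) :=
        Etale.etale_isStableUnderBaseChange.respectsIso
      rw [← MorphismProperty.cancel_left_of_respectsIso @Etale i.hom,
        ← MorphismProperty.cancel_right_of_respectsIso @Etale _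
          (AffineSpace.SpecIso PUnit.{u + 1} (.of k)).hom]
      have h1 : i.hom ≫ toAffineLine X U u = Spec.map (CommRingCat.ofHom
          (MvPolynomial.eval₂Hom (φ.comp C) fun _ ↦ φ Polynomial.X)) ≫
            (AffineSpace.SpecIso PUnit.{u + 1} (.of k)).inv := by
        rw [← SpecMap_comp_SpecIso_inv, toAffineLine, AffineSpace.comp_homOfVector,
          ← Category.assoc, hi, hj]
        congr 1
        ext _
        apply (ConcreteCategory.bijective_of_isIso (Scheme.ΓSpecIso (.of R)).hom).1
        rw [← CommRingCat.comp_apply, Iso.inv_hom_id]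
        exact ρ.apply_symm_apply _
      rw [h1, Category.assoc, Iso.inv_hom_id, Category.comp_id,
        HasRingHomProperty.Spec_iff (P := @Etale)]
      have h2 : MvPolynomial.eval₂Hom (φ.comp C) (fun _ : PUnit.{u + 1} ↦ φ Polynomial.X) =
          φ.comp (MvPolynomial.uniqueAlgEquiv k PUnit.{u + 1} : _ →+* k[X]) := by
        ext <;> simp
      rw [h2]
      exact RingHom.Etale.stableUnderComposition _ _
        (.of_bijective (RingEquiv.bijective
          (MvPolynomial.uniqueAlgEquiv k PUnit.{u + 1}).toRingEquiv)) hφ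
    infer_instance

end Main

/-! ### The two assertions for an elliptic curve -/

section Main

variable {k : Type u} [Field k]

theorem exists_isSpecialNeighbourhood [IsAlgClosed k] (X : Over (Spec (CommRingCat.of k)))
    (hX : IsEllipticCurve X) (x : X.left) (hx : IsClosed ({x} : Set X.left)) :
    ∃ (U : X.left.Opens) (u : Γ(U.toScheme, ⊤)), IsSpecialNeighbourhood X x hx U u := by
  have := hX.isProper
  obtain ⟨U₀, hU₀, V, hV, hxV, hVU, hstd⟩ :=
    hX.smooth.exists_isStandardSmoothOfRelativeDimension x
  obtain ⟨g, hgC, hg⟩ := hstd.exists_etale_mvPolynomial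
  let p : Spec (.of k) ⟶ X.left := pointOfClosedPoint X.hom x hx
  have hpX : p ≫ X.hom = 𝟙 _ := pointOfClosedPoint_comp X.hom x hx
  have hp (a) : p a = x := pointOfClosedPoint_apply X.hom x hx a
  have : IsClosedImmersion p := isClosedImmersion_of_comp_eq_id _ _ hpX
  have hpr : Set.range p ⊆ Set.range hV.fromSpec := by
    rintro _ ⟨a, rfl⟩
    rw [hV.range_fromSpec, hp]
    exact hxV
  let e := Spec.preimage (IsOpenImmersion.lift hV.fromSpec p hpr)
  have he : Spec.map e ≫ hV.fromSpec = p := by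
    rw [Spec.map_preimage, IsOpenImmersion.lift_fac]
  let κ : CommRingCat.of k ⟶ Γ(Spec (.of k), U₀) := Spec.preimage hU₀.fromSpec
  have hκ : Spec.map κ = hU₀.fromSpec := Spec.map_preimage _
  -- A nonempty open subset of the one-point space `Spec k` is everything, so the base ring of the
  -- smooth presentation is `k` itself.
  have : IsIso (Spec.map κ) := by
    rw [hκ]
    have : Subsingleton (Spec (CommRingCat.of k)) :=
      inferInstanceAs (Subsingleton (PrimeSpectrum k))
    apply isIso_of_isOpenImmersion_of_opensRange_eq_top
    ext y
    simp only [TopologicalSpace.Opens.coe_top, Set.mem_univ, iff_true]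
    rw [Scheme.Hom.coe_opensRange, hU₀.range_fromSpec]
    have : X.hom x = y := Subsingleton.elim _ _
    exact this ▸ hVU hxV
  have hκb : Function.Bijective κ.hom := isIso_SpecMap_iff.mp inferInstance
  have hstr : hV.fromSpec ≫ X.hom = Spec.map (κ ≫ X.hom.appLE U₀ V hVU) := by
    rw [Spec.map_comp, hκ, hU₀.SpecMap_appLE_fromSpec X.hom hV hVU]
  have heC : ((e.hom.comp g).comp MvPolynomial.C).comp κ.hom = RingHom.id k := by
    rw [RingHom.comp_assoc MvPolynomial.C g e.hom, hgC, RingHom.comp_assoc]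
    have : κ ≫ X.hom.appLE U₀ V hVU ≫ e = 𝟙 _ := by
      apply Spec.map_injective
      rw [← Category.assoc, Spec.map_comp, ← hstr, reassoc_of% he, hpX, Spec.map_id]
    exact congr(($this).hom)
  obtain ⟨s, φ, e', hφ, hφC, he', hker, hnzd⟩ := exists_etale_coordinate κ.hom hκb g hg e.hom heC
  let loc := Spec.map (CommRingCat.ofHom (algebraMap Γ(X.left, V) (Localization.Away s)))
  have hep : Spec.map (CommRingCat.ofHom e') ≫ loc ≫ hV.fromSpec = p := by
    rw [← Spec.map_comp_assoc, ← CommRingCat.ofHom_comp, he']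
    exact he
  have : IsOpenImmersion loc := inferInstance
  have : IsClosedImmersion (Spec.map (CommRingCat.ofHom e') ≫ loc ≫ hV.fromSpec) := by
    rwa [hep]
  refine isSpecialNeighbourhood_of_openImmersion X x hx (loc ≫ hV.fromSpec) φ hφ ?_ hnzd e' hker
    (fun a ↦ by rw [hep]; exact hp a)
  rw [Category.assoc, hstr, ← Spec.map_comp, hφC]
  congr 1
  ext a
  simp [← hgC]

theorem ideal_top_ofIdealTop {Z : Scheme.{u}} [IsAffine Z] (I : Ideal Γ(Z, ⊤)) :
    (Scheme.IdealSheafData.ofIdealTop I).ideal ⟨⊤, isAffineOpen_top Z⟩ = I :=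
  Scheme.IdealSheafData.equivOfIsAffine.right_inv I

/-- A closed point of an elliptic curve is not an open subscheme. -/
theorem closedPointOn_ne_bot [IsAlgClosed k] (X : Over (Spec (CommRingCat.of k)))
    (hX : IsEllipticCurve X) (x : X.left) (hx : IsClosed ({x} : Set X.left)) (U : X.left.Opens)
    (hxU : x ∈ U) : closedPointOn x hx U ≠ ⊥ := by
  intro hbot
  have := hX.isIntegral
  have hsub : (U : Set X.left) ⊆ {x} := by
    intro y hy
    have h1 : (closedPointOn x hx U).support = ⊤ := by rw [hbot]; simp
    rw [closedPointOn, Scheme.IdealSheafData.support_comap] at h1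
    have h2 : (⟨y, hy⟩ : U) ∈ (⊤ : TopologicalSpace.Closeds U) := trivial
    rw [← h1] at h2
    have h3 : y ∈ (closedPoint x hx).support := h2
    rwa [closedPoint, ← SetLike.mem_coe, Scheme.IdealSheafData.coe_support_vanishingIdeal] at h3
  have huniv : ({x} : Set X.left) = Set.univ := by
    rw [← hx.closure_eq, ← dense_iff_closure_eq]
    exact (U.isOpen.dense ⟨x, hxU⟩).mono hsub
  -- That `X` is not a single point comes from (1): otherwise the ideal of `x` is zero, yet near `x`
  -- it is generated by a non-zero-divisor.
  obtain ⟨V, u, hV⟩ := exists_isSpecialNeighbourhood X hX x hx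
  have h1 : closedPoint x hx = ⊥ := by
    rw [closedPoint, ← Scheme.nilradical_eq_bot, ← Scheme.IdealSheafData.vanishingIdeal_top]
    congr 1
    ext1
    exact huniv
  have h2 := hV.eq_principal
  rw [closedPointOn, h1, Scheme.IdealSheafData.comap_bot] at h2
  have : IsAffine V.toScheme := hV.isAffine
  have h3 : (⊥ : Ideal Γ(V.toScheme, ⊤)) = Ideal.span {u} := by
    rw [← ideal_top_ofIdealTop (Z := V.toScheme) (Ideal.span {u}), ← h2]
    rfl
  have hu : u = 0 := Ideal.span_singleton_eq_bot.mp h3.symm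
  have : Nonempty V.toScheme := ⟨⟨x, hV.mem⟩⟩
  exact nonZeroDivisors.ne_zero hV.mem_nonZeroDivisors hu

theorem not_exists_isFinite [IsAlgClosed k] (X : Over (Spec (CommRingCat.of k)))
    (hX : IsEllipticCurve X) (x : X.left) (hx : IsClosed ({x} : Set X.left)) (U : X.left.Opens)
    (hU : IsAffineOpen U) (hxU : x ∈ U) (f : U.toScheme ⟶ AffineLine k) [IsFinite f]
    (hf : f ≫ (AffineLine k ↘ Spec (CommRingCat.of k)) = U.ι ≫ X.hom)
    (D : (AffineLine k).IdealSheafData) : closedPointOn x hx U ≠ D.comap f := by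
  intro hD
  have := hX.isProper
  have := hX.isIntegral
  obtain ⟨_⟩ := hX.nonempty_grpObj
  have : IsAffine U.toScheme := hU
  have : Nonempty U.toScheme := ⟨⟨x, hxU⟩⟩
  let p : Spec (.of k) ⟶ X.left := pointOfClosedPoint X.hom x hx
  have hpX : p ≫ X.hom = 𝟙 _ := pointOfClosedPoint_comp X.hom x hx
  have hp (a) : p a = x := pointOfClosedPoint_apply X.hom x hx a
  have : IsClosedImmersion p := isClosedImmersion_of_comp_eq_id _ _ hpX
  let q : Spec (.of k) ⟶ U.toScheme := IsOpenImmersion.lift U.ι p (by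
    rintro _ ⟨a, rfl⟩
    rw [Scheme.Opens.range_ι, hp]
    exact hxU)
  have hq : q ≫ U.ι = p := IsOpenImmersion.lift_fac _ _ _
  have hker := closedPointOn_eq_ker x hx p hp U q hq
  rw [Scheme.ker_of_isAffine] at hker
  -- the coordinate ring of the line
  let ε : k[X] ≃+* Γ(AffineLine k, ⊤) :=
    ((MvPolynomial.uniqueAlgEquiv k PUnit.{u + 1}).symm.toRingEquiv.trans
      (Scheme.ΓSpecIso (.of (MvPolynomial PUnit.{u + 1} k))).symm.commRingCatIsoToRingEquiv).trans
      (Scheme.Γ.mapIso (AffineSpace.SpecIso PUnit.{u + 1} (.of k)).op).commRingCatIsoToRingEquiv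
  let := (f.appTop.hom.comp ε.toRingHom).toAlgebra
  have : Module.Finite k[X] Γ(U.toScheme, ⊤) :=
    RingHom.Finite.comp f.finite_appTop (.of_surjective ε.toRingHom ε.surjective)
  let e : Γ(U.toScheme, ⊤) →+* k := (Scheme.ΓSpecIso (.of k)).hom.hom.comp q.appTop.hom
  have heker : RingHom.ker e = RingHom.ker q.appTop.hom := by
    ext a
    exact map_eq_zero_iff _ (ConcreteCategory.bijective_of_isIso
      (Scheme.ΓSpecIso (.of k)).hom).1
  have hbij : Function.Bijective (algebraMap k[X] Γ(U.toScheme, ⊤)) := by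
    refine bijective_algebraMap_of_map_eq_ker e ?_ ?_
      ((D.ideal ⟨⊤, isAffineOpen_top _⟩).comap ε.toRingHom) ?_
    · have h1 : q ≫ f ≫ (AffineSpace.SpecIso PUnit.{u + 1} (.of k)).hom ≫
          Spec.map (CommRingCat.ofHom MvPolynomial.C) = 𝟙 _ := by
        rw [← AffineSpace.SpecIso_inv_over, Iso.hom_inv_id_assoc, hf, ← Category.assoc, hq, hpX]
      ext a
      have h2 : f.appTop (ε (C a)) = f.appTop ((AffineSpace.SpecIso PUnit.{u + 1} (.of k)).hom.appTop
          ((Spec.map (CommRingCat.ofHom MvPolynomial.C)).appTop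
            ((Scheme.ΓSpecIso (.of k)).inv a))) := by
        have h3 : (MvPolynomial.uniqueAlgEquiv k PUnit.{u + 1}).symm (C a) = MvPolynomial.C a := by
          simp
        refine congrArg (fun b ↦ f.appTop ((AffineSpace.SpecIso PUnit.{u + 1} (.of k)).hom.appTop b))
          (Eq.trans ?_ congr($(Scheme.ΓSpecIso_inv_naturality
            (CommRingCat.ofHom (MvPolynomial.C (R := k) (σ := PUnit.{u + 1})))) a))
        exact congrArg (Scheme.ΓSpecIso _).inv h3
      have h3 := congr(($h1).appTop ((Scheme.ΓSpecIso (.of k)).inv a))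
      have h4 : e (f.appTop (ε (C a))) = a := by
        rw [h2]
        refine (congrArg (Scheme.ΓSpecIso (.of k)).hom h3).trans ?_
        simp
      exact h4
    -- If evaluation at `x` were injective, the closed point would be all of `U`.
    · intro h0
      refine closedPointOn_ne_bot X hX x hx U hxU ?_
      rw [hker, ← heker, h0]
      exact Scheme.IdealSheafData.ext_of_isAffine (by simp)
    · rw [hker] at hD
      have h1 := congr(($hD).ideal ⟨⊤, isAffineOpen_top _⟩)
      rw [comap_ideal_top, ideal_top_ofIdealTop] at h1
      rw [heker, h1, RingHom.algebraMap_toAlgebra, ← Ideal.map_map,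
        Ideal.map_comap_of_surjective ε.toRingHom ε.surjective]
  have hfb : Function.Bijective f.appTop.hom := by
    have : Function.Bijective (f.appTop.hom ∘ ε) := hbij
    rwa [Function.Bijective.of_comp_iff _ ε.bijective] at this
  have : IsIso f.appTop := (ConcreteCategory.isIso_iff_bijective _).mpr hfb
  -- Source and target are affine, so bijectivity on global sections suffices; `inv f` then embeds
  -- the line in `X` as an open subscheme.
  have : IsIso f := ((MorphismProperty.isomorphisms Scheme.{u}).arrow_mk_iso_iff
    (arrowIsoSpecΓOfIsAffine f)).mpr (inferInstanceAs (IsIso (Spec.map f.appTop)))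
  refine not_isOpenImmersion_of_grpObj X (Spec.map (CommRingCat.ofHom
    (MvPolynomial.uniqueAlgEquiv k PUnit.{u + 1} : MvPolynomial PUnit.{u + 1} k →+* k[X])) ≫
      (AffineSpace.SpecIso PUnit.{u + 1} (.of k)).inv ≫ inv f ≫ U.ι) ?_ ?_
  · rw [Category.assoc, Category.assoc, Category.assoc, ← hf, IsIso.inv_hom_id_assoc,
      AffineSpace.SpecIso_inv_over, ← Spec.map_comp, ← CommRingCat.ofHom_comp]
    congr 2
    ext a
    simp
  · have : IsIso (Spec.map (CommRingCat.ofHom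
        (MvPolynomial.uniqueAlgEquiv k PUnit.{u + 1} : MvPolynomial PUnit.{u + 1} k →+* k[X]))) :=
      isIso_SpecMap_iff.mpr (MvPolynomial.uniqueAlgEquiv k PUnit.{u + 1}).bijective
    infer_instance

end Main

end Sharpness

theorem mainTheorem8 {k : Type u} [Field k] [IsAlgClosed k]
    (X : Over (Spec (CommRingCat.of k))) (hX : Sharpness.IsEllipticCurve X)
    (x : X.left) (hx : IsClosed ({x} : Set X.left)) :
    (∃ (U : X.left.Opens) (u : Γ(U.toScheme, ⊤)),
      Sharpness.IsSpecialNeighbourhood X x hx U u) ∧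
    ∀ U : X.left.Opens, IsAffineOpen U → x ∈ U →
      ¬ ∃ (f : U.toScheme ⟶ Sharpness.AffineLine k)
          (D' : (Sharpness.AffineLine k).IdealSheafData),
        f ≫ (Sharpness.AffineLine k ↘ Spec (CommRingCat.of k)) = U.ι ≫ X.hom ∧
        IsFinite f ∧
        Sharpness.IsEffectiveCartier D' ∧
        Sharpness.closedPointOn x hx U = D'.comap f := by
  refine ⟨Sharpness.exists_isSpecialNeighbourhood X hX x hx, ?_⟩
  rintro U hU hxU ⟨f, D', hf, hfin, -, hD⟩
  exact Sharpness.not_exists_isFinite X hX x hx U hU hxU f hf D' hD
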